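/- Let $\mathbb F$ be a field and $\Gamma\subset\mathbb R$ an additive subgroup. Let $\Lambda^{\mathbb F,\Gamma}$ be the Novikov field of formal series $\lambda=\sum_{\gamma\in\Gamma}a_\gamma s^\gamma$, $a_\gamma\in\mathbb F$, such that $\{\gamma\mid a_\gamma\ne0,\ \gamma<B\}$ is finite for every $B\in\mathbb R$, with the valuation $\nu(\lambda)=\min\{\gamma\mid a_\gamma\neq 0\}$, $\nu(0)=\infty$. A *Floer-type complex* $(C_*,\partial,\ell)$ over $\Lambda^{\mathbb F,\Gamma}$ is a chain complex $(C_k)_{k\in\mathbb Z}$, $\partial\colon C_k\to C_{k-1}$, of $\Lambda^{\mathbb F,\Gamma}$-vector spaces together with functions $\ell\colon C_k\to\mathbb R\cup\{-\infty\}$ such that $\ell(\partial x)\le\ell(x)$ for all $x\in C_k$ and, for every $k$: 1. $\ell(x)=-\infty$ if and only if $x=0$; $\ell(\lambda x)=\ell(x)-\nu(\lambda)$; and $\ell(x+y)\le\max\{\ell(x),\ell(y)\}$; 2. $C_k$ is finite-dimensional and has a basis $w_1,\dots,w_n$ with $\ell\bigl(\sum_i\lambda_iw_i\bigr)=\max_i\bigl(\ell(w_i)-\nu(\lambda_i)\bigr)$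 for all $\lambda_1,\dots,\lambda_n\in\Lambda^{\mathbb F,\Gamma}$. For $t\in\mathbb R$ put $C_k^t=\{x\in C_k\mid \ell(x)\le t\}$. For $a\le b$ let $C_*^{(a,b]}=C_*^b/C_*^a$, and for $a>b$ let $C_*^{(a,b]}=0$; these are complexes of $\mathbb F$-vector spaces. Put $H_k^{(a,b]}=H_k\bigl(C_*^{(a,b]}\bigr)$. For $a\le a'$ and $b\le b'$, the inclusion $C_*^b\subset C_*^{b'}$ and the projection modulo $C_*^{a'}$ induce a linear map $H_k^{(a,b]}\to H_k^{(a',b']}$ (zero if $a>b$ or $a'>b'$). With these maps, $(a,b)\mapsto H_k^{(a,b]}$ is a functor $\mathbb H_k^{(\bullet,\bullet]}(C_*)$ from $\mathbb R^2$, with the componentwise order, to $\mathbb F$-vector spaces. An *interval* in a partially ordered set is a non-empty subset $I$ that is convex ($x\preceq z\preceq y$ with $x,y\in I$ implies $z\in I$) and in which any two elements are joined by a finite chain of elements of $I$, consecutive ones being comparable. A *rectangle* in $\mathbb R^2$ is an interval of the form $I_1\times I_2$ with $I_1,I_2$ intervals in $\mathbb R$. The *interval module* $\mathbb F_I$ of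 an interval $I$ is the functor that is $\mathbb F$ at the points of $I$ and $0$ elsewhere, with the identity as structure map between any two comparable points of $I$ and zero structure maps otherwise. For $c\in\mathbb R$ and $\ell_1,\ell_2\in(0,\infty]$ let $$R(c;\ell_1,\ell_2)=[c-\ell_1,c)\times[c,c+\ell_2),$$ where the first factor is $(-\infty,c)$ if $\ell_1=\infty$ and the second is $[c,\infty)$ if $\ell_2=\infty$. Its bottom right corner is $(c,c)$. It is of type (S) if $\ell_1=\ell_2=\infty$, of type (B) if $\ell_1=\infty$ and $\ell_2<\infty$, of type (N) if $\ell_1<\infty$ and $\ell_2=\infty$, and of type (R) if $\ell_1,\ell_2<\infty$. **Theorem.** Let $(C_*,\partial,\ell)$ be a Floer-type complex over $\Lambda^{\mathbb F,\Gamma}$ and $k\in\mathbb Z$. If $\Gamma=\{0\}$ (so that $\Lambda^{\mathbb F,\Gamma}=\mathbb F$), then there exists a multiset $\mathcal B$ of rectangles in $\mathbb R^2$ such that $$\mathbb H_k^{(\bullet,\bullet]}(C_*)\cong\bigoplus_{R\in\mathcal B}\mathbb F_R$$ as functors on $\mathbb R^2$, where the direct sum is pointwise. Moreover, every $R\in\mathcal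 B$ has its bottom right corner on the diagonal, i.e. $R=R(c;\ell_1,\ell_2)$ for some $c\in\mathbb R$ and $\ell_1,\ell_2\in(0,\infty]$, and is of type (S), (B) or (N); it is never of type (R). -/

import Mathlib

open CategoryTheory
open scoped DirectSum ENNReal

universe u v w

/-! ### The Novikov field -/

section NovikovField

variable (F : Type u) [Field F] (Γ : AddSubgroup ℝ)

/-- Auxiliary closure property: if `x` has finitely many exponents below every real number, then so
does its inverse in the field of Hahn series. -/
theorem novikov_inv_mem (x : HahnSeries Γ F)
    (hx : ∀ B : ℝ, {γ : Γ | γ ∈ x.support ∧ (γ : ℝ) < B}.Finite) (B : ℝ) :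
    {γ : Γ | γ ∈ (x⁻¹).support ∧ (γ : ℝ) < B}.Finite := by
  by_cases h0 : x = 0
  · subst h0; simp
  set z := x⁻¹ with hz
  have hxz : x * z = 1 := mul_inv_cancel₀ h0
  have hm : x.coeff x.order ≠ 0 := mt HahnSeries.coeff_order_eq_zero.1 h0
  obtain ⟨ε, hε, hgap⟩ : ∃ ε : ℝ, 0 < ε ∧ ∀ i ∈ x.support, i ≠ x.order →
      (x.order : ℝ) + ε ≤ i := by
    have hfin : {γ : Γ | γ ∈ x.support ∧ (γ : ℝ) < (x.order : ℝ) + 1 ∧ γ ≠ x.order}.Finite :=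
      (hx ((x.order : ℝ) + 1)).subset fun γ h => ⟨h.1, h.2.1⟩
    have hlt : ∀ i ∈ x.support, i ≠ x.order → (x.order : ℝ) < i := fun i hi hne =>
      lt_of_le_of_ne (HahnSeries.order_le_of_coeff_ne_zero hi) fun h => hne (Subtype.ext h).symm
    rcases hfin.toFinset.eq_empty_or_nonempty with he | hne
    · refine ⟨1, one_pos, fun i hi hne => ?_⟩
      by_contra hlt'
      have : i ∈ hfin.toFinset := by simpa using ⟨hi, not_le.1 hlt', hne⟩
      rw [he] at this
      exact Finset.notMem_empty _ this
    · obtain ⟨g, hg, hmin⟩ := hfin.toFinset.exists_min_image (fun γ : Γ => (γ : ℝ)) hne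
      have hg' := hfin.mem_toFinset.1 hg
      refine ⟨(g : ℝ) - x.order, sub_pos.2 (hlt g hg'.1 hg'.2.2), fun i hi hne => ?_⟩
      by_cases hi1 : (i : ℝ) < (x.order : ℝ) + 1
      · have := hmin i (hfin.mem_toFinset.2 ⟨hi, hi1, hne⟩)
        linarith
      · have := hg'.2.1
        linarith
  have hstep : ∀ g ∈ z.support, g + x.order ≠ 0 →
      ∃ i ∈ x.support, i ≠ x.order ∧ ∃ j ∈ z.support, i + j = x.order + g := by
    intro g hg hg0
    by_contra hcon
    push Not at hcon
    have h1 : (x * z).coeff (x.order + g) = 0 := by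
      rw [hxz, HahnSeries.coeff_one, if_neg]
      rwa [add_comm]
    rw [HahnSeries.coeff_mul, Finset.sum_eq_single (x.order, g)] at h1
    · exact (mul_ne_zero hm hg) h1
    · rintro ⟨i, j⟩ hij hne
      rw [Finset.mem_antidiagonal] at hij
      exfalso
      by_cases hi : i = x.order
      · subst hi
        exact hne (Prod.ext rfl (add_left_cancel hij.2.2))
      · exact hcon i hij.1 hi j hij.2.1 hij.2.2
    · intro hnot
      exfalso
      exact hnot (by rw [Finset.mem_antidiagonal]; exact ⟨hm, hg, rfl⟩)
  have hord : ∀ j ∈ z.support, (z.order : ℝ) ≤ j := fun j hj =>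
    HahnSeries.order_le_of_coeff_ne_zero hj
  have key : ∀ n : ℕ, {γ : Γ | γ ∈ z.support ∧ (γ : ℝ) < (z.order : ℝ) + n * ε}.Finite := by
    intro n
    induction n with
    | zero =>
      convert Set.finite_empty (α := Γ)
      ext γ
      simp only [Set.mem_ofPred_eq, Set.mem_empty_iff_false, iff_false, not_and, not_lt]
      intro h
      simpa using hord γ h
    | succ n ih =>
      refine ((Set.finite_singleton (-x.order)).union
        (Set.Finite.image2 (fun i j : Γ => i + j - x.order)
          (hx ((n + 1 : ℕ) * ε + x.order + 1)) ih)).subset ?_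
      rintro g ⟨hg, hgB⟩
      by_cases hg0 : g + x.order = 0
      · left
        exact eq_neg_of_add_eq_zero_left hg0
      · right
        obtain ⟨i, hi, hne, j, hj, hij⟩ := hstep g hg hg0
        have hij' : (i : ℝ) + j = x.order + g := by exact_mod_cast congrArg Subtype.val hij
        have h1 := hgap i hi hne
        have h2 := hord j hj
        push_cast at hgB ⊢
        refine ⟨i, ⟨hi, by linarith⟩, j, ⟨hj, by linarith⟩, ?_⟩
        change i + j - x.order = g
        rw [hij, add_sub_cancel_left]
  obtain ⟨n, hn⟩ := exists_nat_gt ((B - z.order) / ε)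
  refine (key n).subset fun γ h => ⟨h.1, ?_⟩
  rw [div_lt_iff₀ hε] at hn
  have := h.2
  linarith

/-- The Novikov field `Λ^{F,Γ}`: formal series `∑ a_γ s^γ` over `γ ∈ Γ` with coefficients in `F`,
having only finitely many nonzero coefficients below every real bound. It is realised as a subfield
of the field of Hahn series (such a set of exponents is automatically well-ordered). -/
noncomputable def Novikov : Subfield (HahnSeries Γ F) where
  carrier := {x | ∀ B : ℝ, {γ : Γ | γ ∈ x.support ∧ (γ : ℝ) < B}.Finite}
  mul_mem' := by
    intro x y hx hy B
    by_cases hx0 : x = 0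
    · subst hx0; simp
    by_cases hy0 : y = 0
    · subst hy0; simp
    refine (Set.Finite.image2 (fun i j : Γ => i + j) (hx (B - y.order))
      (hy (B - x.order))).subset ?_
    rintro g ⟨hg, hgB⟩
    obtain ⟨i, hi, j, hj, rfl⟩ := HahnSeries.support_mul_subset hg
    have h1 : (x.order : ℝ) ≤ i := HahnSeries.order_le_of_coeff_ne_zero hi
    have h2 : (y.order : ℝ) ≤ j := HahnSeries.order_le_of_coeff_ne_zero hj
    push_cast at hgB
    exact ⟨i, ⟨hi, by linarith⟩, j, ⟨hj, by linarith⟩, rfl⟩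
  one_mem' := by
    intro B
    refine (Set.finite_singleton (0 : Γ)).subset fun γ h => ?_
    simpa using h.1
  add_mem' := by
    intro x y hx hy B
    refine ((hx B).union (hy B)).subset ?_
    rintro g ⟨hg, hgB⟩
    rcases HahnSeries.support_add_subset x y hg with h | h
    · exact Or.inl ⟨h, hgB⟩
    · exact Or.inr ⟨h, hgB⟩
  zero_mem' := by
    intro B
    simp
  neg_mem' := by
    intro x hx B
    simpa using hx B
  inv_mem' := novikov_inv_mem F Γ

/-- The inclusion `F → Λ^{F,Γ}` of the ground field as the constant series `a = a s^0`. -/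
noncomputable def Novikov.const : F →+* Novikov F Γ :=
  (HahnSeries.C : F →+* HahnSeries Γ F).codRestrict (Novikov F Γ) (by
    intro a B
    refine (Set.finite_singleton (0 : Γ)).subset fun γ h => ?_
    exact HahnSeries.support_single_subset h.1)

variable {F Γ}

open scoped Classical in
/-- The valuation `ν(∑ a_γ s^γ) = min {γ | a_γ ≠ 0}`, with `ν(0) = ∞`. -/
noncomputable def novikovVal (x : Novikov F Γ) : EReal :=
  if x = 0 then ⊤ else (((x : HahnSeries Γ F).order : ℝ) : EReal)

theorem novikovVal_zero : novikovVal (0 : Novikov F Γ) = ⊤ := if_pos rfl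

theorem novikovVal_const {c : F} (hc : c ≠ 0) : novikovVal (Novikov.const F Γ c) = 0 := by
  have h : Novikov.const F Γ c ≠ 0 := (map_ne_zero _).2 hc
  have h2 : ((Novikov.const F Γ c : Novikov F Γ) : HahnSeries Γ F) = HahnSeries.C c := rfl
  rw [novikovVal, if_neg h, h2, HahnSeries.order_C]
  simp

end NovikovField

/-! ### Non-archimedean normed vector spaces and Floer-type complexes -/

section FloerType

variable {F : Type u} [Field F] {Γ : AddSubgroup ℝ}

/-- `ℓ : V → ℝ ∪ {-∞}` makes `V` a non-archimedean normed vector space over the Novikov field. -/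
structure IsNonarchimedeanNorm {V : Type w} [AddCommGroup V] [Module (Novikov F Γ) V]
    (ℓ : V → EReal) : Prop where
  ne_top : ∀ x, ℓ x ≠ ⊤
  eq_bot_iff : ∀ x, ℓ x = ⊥ ↔ x = 0
  map_smul : ∀ (c : Novikov F Γ) (x : V), ℓ (c • x) = ℓ x - novikovVal c
  map_add_le : ∀ x y, ℓ (x + y) ≤ max (ℓ x) (ℓ y)

/-- A non-archimedean normed vector space is (finite-dimensional and) orthogonalizable if it has a
finite orthogonal basis. The supremum is a maximum over a finite set, equal to `-∞` if that set is
empty. -/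
def IsOrthogonalizable {V : Type w} [AddCommGroup V] [Module (Novikov F Γ) V]
    (ℓ : V → EReal) : Prop :=
  IsNonarchimedeanNorm (F := F) (Γ := Γ) ℓ ∧
    ∃ (n : ℕ) (b : Module.Basis (Fin n) (Novikov F Γ) V),
      ∀ c : Fin n → Novikov F Γ,
        ℓ (∑ i, c i • b i) = Finset.univ.sup fun i => ℓ (b i) - novikovVal (c i)

variable (F Γ) in
/-- A Floer-type complex over the Novikov field `Λ^{F,Γ}`. The filtration function is given by its
restrictions to the chain groups. -/
structure FloerTypeComplex where
  /-- the underlying chain complex, with `d i j : C_i → C_j` nonzero only for `i = j + 1` -/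
  complex : ChainComplex (ModuleCat.{w} (Novikov F Γ)) ℤ
  /-- the filtration function, with values in `ℝ ∪ {-∞}` -/
  ℓ : ∀ k : ℤ, complex.X k → EReal
  orthogonalizable : ∀ k, IsOrthogonalizable (F := F) (Γ := Γ) (ℓ k)
  ℓ_d_le : ∀ (i j : ℤ) (x : complex.X i), ℓ j (complex.d i j x) ≤ ℓ i x

namespace FloerTypeComplex

variable (C : FloerTypeComplex.{u, w} F Γ)

/-- The underlying chain complex of vector spaces over the ground field. -/
noncomputable def groundComplex : ChainComplex (ModuleCat.{w} F) ℤ :=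
  ((ModuleCat.restrictScalars (Novikov.const F Γ)).mapHomologicalComplex _).obj C.complex

/-- The filtration level `C_k^t = {x ∈ C_k | ℓ(x) ≤ t}`, a vector space over the ground field. -/
noncomputable def sublevel (t : ℝ) (k : ℤ) : Submodule F (C.groundComplex.X k) where
  carrier := {x | C.ℓ k x ≤ (t : EReal)}
  zero_mem' := by
    change C.ℓ k (0 : C.complex.X k) ≤ _
    rw [((C.orthogonalizable k).1.eq_bot_iff 0).2 rfl]
    exact bot_le
  add_mem' := fun {x y} hx hy =>
    ((C.orthogonalizable k).1.map_add_le (V := C.complex.X k) x y).trans (max_le hx hy)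
  smul_mem' := fun c x hx => by
    refine ((C.orthogonalizable k).1.map_smul (V := C.complex.X k) (Novikov.const F Γ c) x).trans_le ?_
    by_cases hc : c = 0
    · subst hc
      rw [map_zero, novikovVal_zero, EReal.sub_top]
      exact bot_le
    · rw [novikovVal_const hc, sub_zero]
      exact hx

theorem sublevel_mono {s t : ℝ} (h : s ≤ t) (k : ℤ) : C.sublevel s k ≤ C.sublevel t k :=
  fun _ hx => le_trans (α := EReal) hx (EReal.coe_le_coe_iff.2 h)

theorem d_mem_sublevel (t : ℝ) (i j : ℤ) :
    C.sublevel t i ≤ (C.sublevel t j).comap (C.groundComplex.d i j).hom :=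
  fun x hx => (C.ℓ_d_le i j x).trans hx

/-- The chain group `C_k^{(a,b]}` as an `F`-vector space: the quotient of `C_k^b` by `C_k^a ∩ C_k^b`.
For `a ≤ b` this is `C_k^b / C_k^a`, and for `b ≤ a` it is the zero space. -/
abbrev InterlevelChains (a b : ℝ) (k : ℤ) : Type w :=
  C.sublevel b k ⧸ (C.sublevel a k).submoduleOf (C.sublevel b k)

theorem subsingleton_interlevelChains {a b : ℝ} (h : b ≤ a) (k : ℤ) :
    Subsingleton (C.InterlevelChains a b k) :=
  Submodule.Quotient.subsingleton_iff.2
    (Submodule.submoduleOf_eq_top.2 (C.sublevel_mono h k))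

/-- The boundary operator of `C_*^{(a,b]}`, induced by that of `C_*`. -/
noncomputable def interlevelD (a b : ℝ) (i j : ℤ) :
    C.InterlevelChains a b i →ₗ[F] C.InterlevelChains a b j :=
  Submodule.mapQ _ _ ((C.groundComplex.d i j).hom.restrict (C.d_mem_sublevel b i j))
    fun x hx => C.d_mem_sublevel a i j (x := (x : C.groundComplex.X i)) hx

/-- The map `C_k^{(a,b]} → C_k^{(a',b']}` for `a ≤ a'` and `b ≤ b'` induced by the inclusion
`C_k^b ⊆ C_k^{b'}`. It is the composite, in either order, of the map induced by this inclusion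
with the projection induced by `C_k^a ⊆ C_k^{a'}`; it vanishes if `b ≤ a` or `b' ≤ a'`. -/
noncomputable def interlevelMap {a a' b b' : ℝ} (ha : a ≤ a') (hb : b ≤ b') (k : ℤ) :
    C.InterlevelChains a b k →ₗ[F] C.InterlevelChains a' b' k :=
  Submodule.mapQ _ _ (Submodule.inclusion (C.sublevel_mono hb k))
    fun x hx => C.sublevel_mono ha k (x := (x : C.groundComplex.X k)) hx

/-- The interlevel chain complex `C_*^{(a,b]}` over the ground field. -/
noncomputable def interlevelComplex (a b : ℝ) : ChainComplex (ModuleCat.{w} F) ℤ where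
  X k := ModuleCat.of F (C.InterlevelChains a b k)
  d i j := ModuleCat.ofHom (C.interlevelD a b i j)
  shape i j hij := by
    ext x
    change Submodule.Quotient.mk _ = Submodule.Quotient.mk 0
    congr 1
    ext
    change (C.groundComplex.d i j).hom (x : C.groundComplex.X i) = 0
    rw [C.groundComplex.shape i j hij]
    rfl
  d_comp_d' i j k _ _ := by
    ext x
    change Submodule.Quotient.mk _ = Submodule.Quotient.mk 0
    congr 1
    ext
    change (C.groundComplex.d i j ≫ C.groundComplex.d j k).hom (x : C.groundComplex.X i) = 0
    rw [C.groundComplex.d_comp_d]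
    rfl

/-- The chain map `C_*^{(a,b]} → C_*^{(a',b']}` for `a ≤ a'` and `b ≤ b'`. -/
noncomputable def interlevelChainMap {a a' b b' : ℝ} (ha : a ≤ a') (hb : b ≤ b') :
    C.interlevelComplex a b ⟶ C.interlevelComplex a' b' where
  f k := ModuleCat.ofHom (C.interlevelMap ha hb k)
  comm' i j _ := by
    ext x
    obtain ⟨x, rfl⟩ := Submodule.Quotient.mk_surjective _ x
    rfl

theorem interlevelChainMap_id (a b : ℝ) :
    C.interlevelChainMap (le_refl a) (le_refl b) = 𝟙 _ := by
  ext k x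
  obtain ⟨x, rfl⟩ := Submodule.Quotient.mk_surjective _ x
  rfl

theorem interlevelChainMap_comp {a a' a'' b b' b'' : ℝ} (ha : a ≤ a') (hb : b ≤ b')
    (ha' : a' ≤ a'') (hb' : b' ≤ b'') :
    C.interlevelChainMap (ha.trans ha') (hb.trans hb') =
      C.interlevelChainMap ha hb ≫ C.interlevelChainMap ha' hb' := by
  ext k x
  obtain ⟨x, rfl⟩ := Submodule.Quotient.mk_surjective _ x
  rfl

end FloerTypeComplex
end FloerType

/-! ### Persistence modules, intervals and rectangles -/

/-- A `P`-indexed persistence module over `F`: a functor from the poset `P` to `F`-vector spaces. -/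
abbrev PersistenceModule (F : Type u) [Field F] (P : Type v) [PartialOrder P] :=
  P ⥤ ModuleCat.{w} F

/-- The persistence module given by vector spaces `M x` and compatible maps `M x → M y`, `x ≤ y`. -/
def PersistenceModule.ofLE {F : Type u} [Field F] {P : Type v} [PartialOrder P]
    (M : P → ModuleCat.{w} F) (φ : ∀ {x y : P}, x ≤ y → (M x ⟶ M y))
    (φ_refl : ∀ x : P, φ (le_refl x) = 𝟙 (M x))
    (φ_trans : ∀ {x y z : P} (h : x ≤ y) (h' : y ≤ z), φ (h.trans h') = φ h ≫ φ h') :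
    PersistenceModule.{u, v, w} F P where
  obj := M
  map f := φ (leOfHom f)
  map_id x := φ_refl x
  map_comp f g := φ_trans (leOfHom f) (leOfHom g)

/-- The pointwise direct sum of a family of persistence modules. -/
noncomputable def PersistenceModule.directSum {F : Type u} [Field F] {P : Type v} [PartialOrder P]
    {ι : Type} (M : ι → PersistenceModule.{u, v, w} F P) : PersistenceModule.{u, v, w} F P where
  obj x := ModuleCat.of F (⨁ i, (M i).obj x)
  map f := ModuleCat.ofHom (DirectSum.lmap fun i => ((M i).map f).hom)
  map_id x := by
    simp only [CategoryTheory.Functor.map_id, ModuleCat.hom_id, DirectSum.lmap_id]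
    rfl
  map_comp f g := by
    simp only [CategoryTheory.Functor.map_comp, ModuleCat.hom_comp, DirectSum.lmap_comp]
    rfl

/-- Intervals in a poset: non-empty, convex and connected (through chains of comparable elements)
subsets. -/
structure IsPosetInterval {P : Type v} [PartialOrder P] (I : Set P) : Prop where
  nonempty : I.Nonempty
  convex : ∀ x ∈ I, ∀ y ∈ I, ∀ z, x ≤ z → z ≤ y → z ∈ I
  connected : ∀ x ∈ I, ∀ y ∈ I,
    Relation.ReflTransGen (fun s t => s ∈ I ∧ t ∈ I ∧ (s ≤ t ∨ t ≤ s)) x y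

/-- Rectangles in a product of two posets: intervals that are products of two intervals. -/
def IsRectangle {P : Type v} {Q : Type w} [PartialOrder P] [PartialOrder Q]
    (R : Set (P × Q)) : Prop :=
  IsPosetInterval R ∧ ∃ (I : Set P) (J : Set Q), IsPosetInterval I ∧ IsPosetInterval J ∧ R = I ×ˢ J

section IntervalModule

variable (F : Type u) [Field F] {P : Type w}

open scoped Classical in
/-- The space of the interval module of `I` at `x`: it is `F` if `x ∈ I` and `0` otherwise. (The copy
`ULift F` of `F` only serves to place it in a larger universe.) -/
noncomputable def intervalSpace (I : Set P) (x : P) : Submodule F (ULift.{v} F) :=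
  if x ∈ I then ⊤ else ⊥

variable {F} in
theorem intervalSpace_eq {I : Set P} {x y : P} (h : x ∈ I ∧ y ∈ I) :
    intervalSpace.{u, v, w} F I x = intervalSpace.{u, v, w} F I y := by
  rw [intervalSpace, intervalSpace, if_pos h.1, if_pos h.2]

open scoped Classical in
/-- The structure map of the interval module of `I`: the identity of `F` if `x, y ∈ I`, and `0`
otherwise. -/
noncomputable def intervalMap (I : Set P) (x y : P) :
    intervalSpace.{u, v, w} F I x →ₗ[F] intervalSpace.{u, v, w} F I y :=
  if h : x ∈ I ∧ y ∈ I then Submodule.inclusion (intervalSpace_eq h).le else 0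

variable {F} in
theorem intervalSpace_eq_zero {I : Set P} {x : P} (h : x ∉ I)
    (t : intervalSpace.{u, v, w} F I x) : t = 0 := by
  obtain ⟨t, ht⟩ := t
  rw [intervalSpace, if_neg h, Submodule.mem_bot] at ht
  exact Subtype.ext ht

/-- The interval module `F_I` of an interval `I`. -/
noncomputable def intervalModule [PartialOrder P] (I : Set P) (hI : IsPosetInterval I) :
    PersistenceModule.{u, w, max u v} F P where
  obj x := ModuleCat.of F (intervalSpace.{u, v, w} F I x)
  map {x y} _ := ModuleCat.ofHom (intervalMap.{u, v, w} F I x y)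
  map_id x := by
    refine ModuleCat.hom_ext (LinearMap.ext fun t => ?_)
    by_cases hx : x ∈ I
    · change intervalMap F I x x t = t
      rw [intervalMap, dif_pos ⟨hx, hx⟩]
      rfl
    · exact (intervalSpace_eq_zero hx _).trans (intervalSpace_eq_zero hx _).symm
  map_comp {x y z} f g := by
    refine ModuleCat.hom_ext (LinearMap.ext fun t => ?_)
    change intervalMap F I x z t = intervalMap F I y z (intervalMap F I x y t)
    by_cases hx : x ∈ I
    · by_cases hz : z ∈ I
      · have hy : y ∈ I := hI.convex x hx z hz y (leOfHom f) (leOfHom g)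
        rw [intervalMap, intervalMap, intervalMap, dif_pos ⟨hx, hz⟩, dif_pos ⟨hy, hz⟩,
          dif_pos ⟨hx, hy⟩]
        rfl
      · exact (intervalSpace_eq_zero hz _).trans (intervalSpace_eq_zero hz _).symm
    · rw [intervalSpace_eq_zero hx t, map_zero, map_zero, map_zero]

end IntervalModule

/-- The Floer-type bipersistence module in degree `k`: it sends `(a, b)` to the `k`-th homology
`H_k^{(a,b]}` of the interlevel complex `C_*^{(a,b]}`, with the induced structure maps. -/
noncomputable def FloerTypeComplex.bipersistenceModule {F : Type u} [Field F] {Γ : AddSubgroup ℝ}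
    (C : FloerTypeComplex.{u, w} F Γ) (k : ℤ) : PersistenceModule.{u, 0, w} F (ℝ × ℝ) :=
  PersistenceModule.ofLE (fun p => (C.interlevelComplex p.1 p.2).homology k)
    (fun h => HomologicalComplex.homologyMap (C.interlevelChainMap h.1 h.2) k)
    (fun p => by rw [C.interlevelChainMap_id, HomologicalComplex.homologyMap_id])
    (fun h h' => by
      rw [← HomologicalComplex.homologyMap_comp, ← C.interlevelChainMap_comp])

/-- The rectangle `R(c; ℓ₁, ℓ₂) = [c - ℓ₁, c) × [c, c + ℓ₂)` with bottom right corner `(c, c)`, for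
`ℓ₁, ℓ₂ ∈ (0, ∞]`. If `ℓ₁ = ∞` the first factor is `(-∞, c)`, and if `ℓ₂ = ∞` the second factor is
`[c, ∞)`. -/
def diagRectangle (c : ℝ) (ℓ₁ ℓ₂ : ℝ≥0∞) : Set (ℝ × ℝ) :=
  {x : ℝ | (c : EReal) - (ℓ₁ : EReal) ≤ x ∧ x < c} ×ˢ
    {y : ℝ | c ≤ y ∧ (y : EReal) < (c : EReal) + (ℓ₂ : EReal)}

/-- Type (S): `R(c; ∞, ∞)`. -/
def IsTypeS (R : Set (ℝ × ℝ)) : Prop :=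
  ∃ c : ℝ, R = diagRectangle c ⊤ ⊤

/-- Type (B): `R(c; ∞, ℓ₂)` with `ℓ₂` finite. -/
def IsTypeB (R : Set (ℝ × ℝ)) : Prop :=
  ∃ (c : ℝ) (ℓ₂ : ℝ≥0∞), 0 < ℓ₂ ∧ ℓ₂ < ⊤ ∧ R = diagRectangle c ⊤ ℓ₂

/-- Type (N): `R(c; ℓ₁, ∞)` with `ℓ₁` finite. -/
def IsTypeN (R : Set (ℝ × ℝ)) : Prop :=
  ∃ (c : ℝ) (ℓ₁ : ℝ≥0∞), 0 < ℓ₁ ∧ ℓ₁ < ⊤ ∧ R = diagRectangle c ℓ₁ ⊤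

/-- Type (R): `R(c; ℓ₁, ℓ₂)` with `ℓ₁` and `ℓ₂` finite. -/
def IsTypeR (R : Set (ℝ × ℝ)) : Prop :=
  ∃ (c : ℝ) (ℓ₁ ℓ₂ : ℝ≥0∞), 0 < ℓ₁ ∧ ℓ₁ < ⊤ ∧ 0 < ℓ₂ ∧ ℓ₂ < ⊤ ∧ R = diagRectangle c ℓ₁ ℓ₂

/-! A class in $H_k^{(a,b]}$ is represented by a chain in $Z=C_k^b\cap\partial^{-1}(C_{k-1}^a)$,
modulo $B=(C_k^a\cap C_k^b)+\partial(C_{k+1}^b)$. Only two chains of subspaces of $C_k$ enter: the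
levels $C_k^t$, and the images $\partial(C_{k+1}^t)$ followed by the preimages
$\partial^{-1}(C_{k-1}^t)$. The latter form a single chain because every image lies in
$\ker\partial$, which lies in every preimage.

Two chains of subspaces of a finite-dimensional space have a common adapted basis
(`exists_basis_isAdapted_of_isChain`). Adaptedness survives intersections and sums, so this one
basis is adapted to $Z$ and $B$ for all $(a,b)$ at once. The basis vectors in $Z\setminus B$ give a
basis of $Z/B$, and each basis vector $x$ contributes one interval module, supported where $x\in
Z\setminus B$ (`nonempty_iso_directSum_intervalModule`).

With $c=\ell(x)$ the support always requires $a<c\le b$. A boundary adds only an upper bound on $b$,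
the least level of a primitive; a chain that is not a cycle adds only the lower bound $\ell(\partial
x)\le a$. Since $\partial^2=0$, the two never occur together, so type (R) is absent.

The condition $\Gamma=\{0\}$ makes $C_k$ finite-dimensional over $\mathbb F$ and gives $\ell$
finitely many values, so that least levels of primitives are attained. -/

/-! ### Bases adapted to subspaces -/

section AdaptedBasis

variable {F : Type u} [Field F] {V : Type w} [AddCommGroup V] [Module F V]

/-- A basis is adapted to a subspace if the subspace is spanned by the basis vectors it contains. -/
def Module.Basis.IsAdapted {n : ℕ} (b : Module.Basis (Fin n) F V) (W : Submodule F V) : Prop :=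
  ∀ x ∈ W, ∀ i, b.repr x i ≠ 0 → b i ∈ W

theorem Module.Basis.IsAdapted.inf {n : ℕ} {b : Module.Basis (Fin n) F V} {W W' : Submodule F V}
    (h : b.IsAdapted W) (h' : b.IsAdapted W') : b.IsAdapted (W ⊓ W') :=
  fun x hx i hi => ⟨h x hx.1 i hi, h' x hx.2 i hi⟩

/-- A nonzero coordinate of $y+z$ is nonzero in $y$ or in $z$, and adaptedness applies to that
summand. -/
theorem Module.Basis.IsAdapted.mem_or_mem {n : ℕ} {b : Module.Basis (Fin n) F V}
    {W W' : Submodule F V} (h : b.IsAdapted W) (h' : b.IsAdapted W') {x : V} (hx : x ∈ W ⊔ W')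
    {i : Fin n} (hi : b.repr x i ≠ 0) : b i ∈ W ∨ b i ∈ W' := by
  obtain ⟨y, hy, z, hz, rfl⟩ := Submodule.mem_sup.1 hx
  by_cases h0 : b.repr y i = 0
  · refine Or.inr (h' z hz i fun h1 => hi ?_)
    simp [h0, h1]
  · exact Or.inl (h y hy i h0)

theorem Module.Basis.IsAdapted.sup {n : ℕ} {b : Module.Basis (Fin n) F V} {W W' : Submodule F V}
    (h : b.IsAdapted W) (h' : b.IsAdapted W') : b.IsAdapted (W ⊔ W') := fun _ hx _ hi =>
  (h.mem_or_mem h' hx hi).elim (fun h => Submodule.mem_sup_left h) fun h => Submodule.mem_sup_right h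

/-- This fails for general vectors; for basis vectors it lets membership in $B$ be tested on its two
summands separately. -/
theorem Module.Basis.IsAdapted.mem_sup_iff {n : ℕ} {b : Module.Basis (Fin n) F V}
    {W W' : Submodule F V} (h : b.IsAdapted W) (h' : b.IsAdapted W') {i : Fin n} :
    b i ∈ W ⊔ W' ↔ b i ∈ W ∨ b i ∈ W' :=
  ⟨fun hi => h.mem_or_mem h' hi (by simp), fun hi =>
    hi.elim (fun h => Submodule.mem_sup_left h) fun h => Submodule.mem_sup_right h⟩

/-- Two chains of subspaces of a finite-dimensional vector space have a common adapted basis. -/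
theorem exists_basis_isAdapted_of_isChain (F : Type u) [Field F] (n : ℕ) :
    ∀ (V : Type w) [AddCommGroup V] [Module F V] [FiniteDimensional F V]
      (_ : Module.finrank F V = n) (S T : Set (Submodule F V))
      (_ : IsChain (· ≤ ·) S) (_ : IsChain (· ≤ ·) T),
      ∃ b : Module.Basis (Fin n) F V, ∀ W ∈ S ∪ T, b.IsAdapted W := by
  induction n with
  | zero =>
    intro V _ _ _ hn S T _ _
    exact ⟨Module.finBasisOfFinrankEq F V hn, fun W _ x _ i => i.elim0⟩
  | succ n ih =>
    intro V _ _ _ hn S T hS hT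
    have : Nontrivial V := Module.nontrivial_of_finrank_pos (R := F) (by omega)
    -- The largest proper member of `T`, or `⊥` if there is none. A hyperplane `N` above it contains
    -- every proper member of `T`.
    obtain ⟨M, hM, hMT⟩ : ∃ M : Submodule F V, M ≠ ⊤ ∧ ∀ W ∈ T, W ≠ ⊤ → W ≤ M := by
      rcases Set.eq_empty_or_nonempty {W | W ∈ T ∧ W ≠ ⊤} with he | hne
      · exact ⟨⊥, bot_ne_top, fun W hW hW' => (he.subset ⟨hW, hW'⟩).elim⟩
      · obtain ⟨M, hM, hmax⟩ := wellFounded_gt.has_min _ hne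
        refine ⟨M, hM.2, fun W hW hW' => ?_⟩
        rcases hT.total hW hM.1 with h | h
        · exact h
        · exact (h.eq_of_not_lt (hmax W ⟨hW, hW'⟩)).ge
    obtain ⟨N, hN, hMN⟩ := (eq_top_or_exists_le_coatom M).resolve_left hM
    -- The smallest member of `S` not inside `N`, or `⊤` if there is none. For `e ∈ A` outside `N`,
    -- every member of `S ∪ T` either lies in `N` or contains `e`. So `e` can be added to an adapted
    -- basis of `N`.
    obtain ⟨A, hAN, hAS⟩ : ∃ A : Submodule F V, ¬ A ≤ N ∧ ∀ W ∈ S, ¬ W ≤ N → A ≤ W := by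
      rcases Set.eq_empty_or_nonempty {W | W ∈ S ∧ ¬ W ≤ N} with he | hne
      · exact ⟨⊤, fun h => hN.1 (top_le_iff.1 h), fun W hW hW' => (he.subset ⟨hW, hW'⟩).elim⟩
      · obtain ⟨A, hA, hmin⟩ := wellFounded_lt.has_min _ hne
        refine ⟨A, hA.2, fun W hW hW' => ?_⟩
        rcases hS.total hA.1 hW with h | h
        · exact h
        · exact (h.eq_of_not_lt (hmin W ⟨hW, hW'⟩)).ge
    obtain ⟨e, heA, heN⟩ := Set.not_subset.1 hAN
    have hsup : N ⊔ Submodule.span F {e} = ⊤ :=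
      hN.2 _ (lt_of_le_of_ne le_sup_left fun h =>
        heN (h ▸ Submodule.mem_sup_right (Submodule.mem_span_singleton_self e)))
    have hli : ∀ (c : F), ∀ x ∈ N, c • e + x = 0 → c = 0 := by
      intro c x hx h
      by_contra hc
      refine heN ((N.smul_mem_iff hc).1 ?_)
      rw [eq_neg_of_add_eq_zero_left h]
      exact N.neg_mem hx
    have hsp : ∀ z : V, ∃ c : F, z + c • e ∈ N := by
      intro z
      obtain ⟨y, hy, y', hy', rfl⟩ := Submodule.mem_sup.1 (hsup ▸ Submodule.mem_top : z ∈ _)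
      obtain ⟨c, rfl⟩ := Submodule.mem_span_singleton.1 hy'
      exact ⟨-c, by simpa using hy⟩
    have hrank : Module.finrank F N = n := by
      have h := Submodule.finrank_sup_add_finrank_inf_eq N (Submodule.span F {e})
      have hinf : N ⊓ Submodule.span F {e} = ⊥ := by
        rw [eq_bot_iff]
        rintro x ⟨hx, hx'⟩
        obtain ⟨c, rfl⟩ := Submodule.mem_span_singleton.1 hx'
        have := hli c (-(c • e)) (N.neg_mem hx) (by simp)
        simp [this]
      rw [hsup, hinf, finrank_top, finrank_bot, hn,
        finrank_span_singleton (by rintro rfl; exact heN N.zero_mem)] at h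
      omega
    have hchain : ∀ {U : Set (Submodule F V)}, IsChain (· ≤ ·) U →
        IsChain (· ≤ ·) ((fun W => W.comap N.subtype) '' U) := by
      rintro U hU _ ⟨W, hW, rfl⟩ _ ⟨W', hW', rfl⟩ -
      exact (hU.total hW hW').imp (fun h => Submodule.comap_mono h) fun h => Submodule.comap_mono h
    obtain ⟨b, hb⟩ := ih N hrank _ _ (hchain hS) (hchain hT)
    rw [← Set.image_union] at hb
    have hb' : ∀ W ∈ S ∪ T, b.IsAdapted (W.comap N.subtype) := fun W hW => hb _ ⟨W, hW, rfl⟩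
    let b' := Module.Basis.mkFinCons e b hli hsp
    have hb0 : b' 0 = e := by simp [b', Module.Basis.coe_mkFinCons]
    have hbs : ∀ i : Fin n, b' i.succ = b i := by simp [b', Module.Basis.coe_mkFinCons]
    have hdecomp : ∀ (c : F) (y : N), b'.repr (c • e + y) = Finsupp.cons c (b.repr y) := by
      intro c y
      have hy : ∑ i, b.repr y i • b' i.succ = (y : V) := by
        conv_rhs => rw [← b.sum_repr y]
        rw [AddSubmonoidClass.coe_finsetSum]
        exact Finset.sum_congr rfl fun i _ => by rw [hbs]; rfl
      rw [← LinearEquiv.eq_symm_apply, Module.Basis.repr_symm_apply,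
        Finsupp.linearCombination_apply, Finsupp.sum_fintype _ _ (by simp), Fin.sum_univ_succ, hb0]
      simp only [Finsupp.cons_zero, Finsupp.cons_succ, hy]
    refine ⟨b', fun W hW x hx => ?_⟩
    have hsmall : W ≤ N → ∀ i, b'.repr x i ≠ 0 → b' i ∈ W := by
      intro hWN i hi
      have h : b'.repr x = Finsupp.cons 0 (b.repr ⟨x, hWN hx⟩) := by
        simpa using hdecomp 0 ⟨x, hWN hx⟩
      rw [h] at hi
      cases i using Fin.cases with
      | zero => simp at hi
      | succ i =>
        rw [Finsupp.cons_succ] at hi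
        rw [hbs]
        exact hb' W hW _ hx i hi
    by_cases hWN : W ≤ N
    · exact hsmall hWN
    · have heW : e ∈ W := by
        rcases hW with hW | hW
        · exact hAS W hW hWN heA
        · by_cases hWt : W = ⊤
          · simp [hWt]
          · exact (hWN ((hMT W hW hWt).trans hMN)).elim
      intro i hi
      cases i using Fin.cases with
      | zero => rwa [hb0]
      | succ i =>
        -- Since `e ∈ W`, the component of `x` in `N` is again in `W`, and it carries all
        -- coordinates other than that of `e`.
        obtain ⟨c, hc⟩ := hsp x
        have hx' : x = (-c) • e + (⟨x + c • e, hc⟩ : N) := by simp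
        rw [hx', hdecomp, Finsupp.cons_succ] at hi
        rw [hbs]
        exact hb' W hW _ (W.add_mem hx (W.smul_mem c heW)) i hi

end AdaptedBasis

/-! ### Interval decompositions from adapted bases -/

section IntervalDecomposition

variable {F : Type u} [Field F] {P : Type w} {V : Type (max u v)} [AddCommGroup V]
  [Module F V]

/-- The map `F_I(p) → Z` sending `t` to `t • e`, where `e ∈ Z` if `p ∈ I`. -/
noncomputable def intervalSpaceToSpan (I : Set P) (p : P) (Z : Submodule F V) (e : V)
    (h : p ∈ I → e ∈ Z) : intervalSpace.{u, v, w} F I p →ₗ[F] Z :=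
  ((LinearMap.toSpanSingleton F V e).comp
    (ULift.moduleEquiv.toLinearMap.comp (Submodule.subtype _))).codRestrict Z fun t => by
      by_cases hp : p ∈ I
      · exact Z.smul_mem _ (h hp)
      · rw [intervalSpace_eq_zero hp t, map_zero]
        exact Z.zero_mem

@[simp]
theorem coe_intervalSpaceToSpan (I : Set P) (p : P) (Z : Submodule F V) (e : V)
    (h : p ∈ I → e ∈ Z) (t : intervalSpace.{u, v, w} F I p) :
    (intervalSpaceToSpan I p Z e h t : V) = t.1.down • e := rfl

variable {H : Type (max u v)} [AddCommGroup H] [Module F H]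

open scoped Classical in
/-- The map `⨁ F_{I i}(p) → H` given on the `i`-th summand by `t ↦ π (t • e i)`. -/
noncomputable def directSumIntervalSpaceMap {ι : Type} (I : ι → Set P) (p : P) (Z : Submodule F V)
    (π : Z →ₗ[F] H) (e : ι → V) (h : ∀ i, p ∈ I i → e i ∈ Z) :
    (⨁ i, intervalSpace.{u, v, w} F (I i) p) →ₗ[F] H :=
  DirectSum.toModule F ι H fun i => π.comp (intervalSpaceToSpan (I i) p Z (e i) (h i))

open scoped Classical in
theorem directSumIntervalSpaceMap_lof {ι : Type} (I : ι → Set P) (p : P) (Z : Submodule F V)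
    (π : Z →ₗ[F] H) (e : ι → V) (h : ∀ i, p ∈ I i → e i ∈ Z) (i : ι)
    (t : intervalSpace.{u, v, w} F (I i) p) :
    directSumIntervalSpaceMap I p Z π e h (DirectSum.lof F ι _ i t) =
      π (intervalSpaceToSpan (I i) p Z (e i) (h i) t) :=
  DirectSum.toModule_lof ..

theorem directSumIntervalSpaceMap_apply {ι : Type} [Fintype ι] (I : ι → Set P) (p : P)
    (Z : Submodule F V) (π : Z →ₗ[F] H) (e : ι → V) (h : ∀ i, p ∈ I i → e i ∈ Z)
    (m : ⨁ i, intervalSpace.{u, v, w} F (I i) p) :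
    directSumIntervalSpaceMap I p Z π e h m =
      π (∑ i, intervalSpaceToSpan (I i) p Z (e i) (h i) (m i)) := by
  classical
  induction m using DirectSum.induction_on with
  | zero => simp
  | of i t =>
    rw [← DirectSum.lof_eq_of F, directSumIntervalSpaceMap_lof, Finset.sum_eq_single i]
    · rw [DirectSum.lof_apply]
    · intro i' _ hne
      rw [DirectSum.lof_eq_of, DirectSum.of_eq_of_ne _ _ _ hne, map_zero]
    · simp
  | add m m' hm hm' =>
    simp only [map_add, hm, hm', DirectSum.add_apply, Finset.sum_add_distrib]

/-- By adaptedness, the basis vectors in `Z` span `Z` and those in `B` span `B`, so the ones in `Z`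
but not in `B` map to a basis of the quotient `H`. -/
theorem bijective_directSumIntervalSpaceMap {ι : Type} (I : ι → Set P) (p : P)
    (Z B : Submodule F V) (π : Z →ₗ[F] H) (hπ : Function.Surjective π)
    (hker : ∀ z, π z = 0 ↔ (z : V) ∈ B) {n : ℕ} (b : Module.Basis (Fin n) F V)
    (hbZ : b.IsAdapted Z) (hbB : b.IsAdapted B) (j : ι → Fin n) (hj : Function.Injective j)
    (hmem : ∀ i, p ∈ I i ↔ b (j i) ∈ Z ∧ b (j i) ∉ B)
    (hcover : ∀ i, b i ∈ Z → b i ∉ B → i ∈ Set.range j) :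
    Function.Bijective (directSumIntervalSpaceMap I p Z π (fun i => b (j i))
      fun i hp => ((hmem i).1 hp).1) := by
  classical
  have : Finite ι := Finite.of_injective j hj
  have : Fintype ι := Fintype.ofFinite ι
  constructor
  · rw [injective_iff_map_eq_zero]
    intro m hm
    replace hm : π (∑ i, intervalSpaceToSpan (I i) p Z (b (j i))
        (fun hp => ((hmem i).1 hp).1) (m i)) = 0 := by
      rw [← directSumIntervalSpaceMap_apply, hm]
    rw [hker] at hm
    refine DFinsupp.ext fun i => ?_
    by_cases hp : p ∈ I i
    · by_contra hmi
      -- The coordinate of the sum at `j i` is the scalar `m i`; were it nonzero, adaptedness would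
      -- put `b (j i)` in `B`.
      refine ((hmem i).1 hp).2 (hbB _ hm (j i) ?_)
      rw [AddSubmonoidClass.coe_finsetSum, map_sum, Finsupp.finsetSum_apply,
        Finset.sum_eq_single i]
      · rw [coe_intervalSpaceToSpan, map_smul, Module.Basis.repr_self, Finsupp.smul_single,
          Finsupp.single_eq_same, smul_eq_mul, mul_one]
        exact fun h => hmi (Subtype.ext (ULift.ext _ _ h))
      · intro i' _ hne
        rw [coe_intervalSpaceToSpan, map_smul, Module.Basis.repr_self, Finsupp.smul_single,
          Finsupp.single_eq_of_ne (hj.ne hne).symm]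
      · simp
    · exact intervalSpace_eq_zero hp _
  · intro h
    obtain ⟨z, rfl⟩ := hπ h
    set Ψ := directSumIntervalSpaceMap I p Z π (fun i => b (j i)) fun i hp => ((hmem i).1 hp).1
      with hΨ
    -- The elements of `Z` whose class is in the range, viewed in `V` so that the expansion of `z`
    -- can be checked term by term.
    let N : Submodule F V := ((LinearMap.range Ψ).comap π).map Z.subtype
    have hzN : (z : V) ∈ N := by
      rw [← b.sum_repr (z : V)]
      refine N.sum_mem fun i _ => ?_
      by_cases h0 : b.repr (z : V) i = 0
      · rw [h0, zero_smul]
        exact N.zero_mem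
      refine N.smul_mem _ ?_
      have hiZ := hbZ z z.2 i h0
      refine ⟨⟨b i, hiZ⟩, ?_, rfl⟩
      by_cases hiB : b i ∈ B
      · exact ⟨0, by rw [map_zero, (hker ⟨b i, hiZ⟩).2 hiB]⟩
      · obtain ⟨i, rfl⟩ := hcover i hiZ hiB
        have hp : p ∈ I i := (hmem i).2 ⟨hiZ, hiB⟩
        refine ⟨DirectSum.lof F ι _ i ⟨⟨1⟩, by rw [intervalSpace, if_pos hp]; trivial⟩, ?_⟩
        rw [hΨ, directSumIntervalSpaceMap_lof]
        congr 1
        exact Subtype.ext (one_smul F _)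
    obtain ⟨z', hz', hzz'⟩ := hzN
    rwa [← Subtype.ext hzz']

/-- A persistence module of subquotients `Z p / B p` of a finite-dimensional vector space that has
a basis adapted to all `Z p` and `B p` is a direct sum of interval modules. -/
theorem nonempty_iso_directSum_intervalModule [PartialOrder P]
    (M : PersistenceModule.{u, w, max u v} F P) (Z B : P → Submodule F V)
    (hZ : Monotone Z) (π : ∀ p, Z p →ₗ[F] M.obj p)
    (hπ : ∀ p, Function.Surjective (π p)) (hker : ∀ p z, π p z = 0 ↔ (z : V) ∈ B p)
    (hnat : ∀ {p q : P} (f : p ⟶ q) (z : Z p),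
      (M.map f).hom (π p z) = π q (Submodule.inclusion (hZ (leOfHom f)) z))
    {n : ℕ} (b : Module.Basis (Fin n) F V) (hbZ : ∀ p, b.IsAdapted (Z p))
    (hbB : ∀ p, b.IsAdapted (B p)) {ι : Type} (j : ι → Fin n) (hj : Function.Injective j)
    (R : ι → Set P) (hR : ∀ i, IsPosetInterval (R i))
    (hmem : ∀ i p, p ∈ R i ↔ b (j i) ∈ Z p ∧ b (j i) ∉ B p)
    (hcover : ∀ i p, b i ∈ Z p → b i ∉ B p → i ∈ Set.range j) :
    Nonempty (M ≅ PersistenceModule.directSum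
      fun i => intervalModule.{u, v, w} F (R i) (hR i)) := by
  classical
  refine ⟨(NatIso.ofComponents (fun p => (LinearEquiv.ofBijective _
    (bijective_directSumIntervalSpaceMap R p (Z p) (B p) (π p) (hπ p) (hker p) b (hbZ p) (hbB p)
      j hj (fun i => hmem i p) fun i => hcover i p)).toModuleIso) ?_).symm⟩
  intro p q f
  refine ModuleCat.hom_ext (DirectSum.linearMap_ext F fun i => LinearMap.ext ?_)
  change ∀ t : intervalSpace.{u, v, w} F (R i) p, directSumIntervalSpaceMap R q (Z q) (π q) (fun i => b (j i))
      (fun i hp => ((hmem i q).1 hp).1) (DirectSum.lmap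
        (fun i => intervalMap.{u, v, w} F (R i) p q) (DirectSum.lof F ι _ i t)) =
    (M.map f).hom (directSumIntervalSpaceMap R p (Z p) (π p) (fun i => b (j i))
      (fun i hp => ((hmem i p).1 hp).1) (DirectSum.lof F ι _ i t))
  intro t
  rw [DirectSum.lmap_lof, directSumIntervalSpaceMap_lof, directSumIntervalSpaceMap_lof, hnat]
  by_cases hp : p ∈ R i
  · by_cases hq : q ∈ R i
    · rw [intervalMap, dif_pos ⟨hp, hq⟩]
      rfl
    · rw [intervalSpace_eq_zero hq (intervalMap F (R i) p q t), map_zero, map_zero, eq_comm, hker]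
      -- The vector stays in `Z q` by monotonicity, so it can leave the support only by entering `B
      -- q`.
      refine (B q).smul_mem _ ?_
      by_contra hcon
      exact hq ((hmem i q).2 ⟨hZ (leOfHom f) ((hmem i p).1 hp).1, hcon⟩)
  · rw [intervalSpace_eq_zero hp t]
    simp only [map_zero]

end IntervalDecomposition

/-! ### Rectangles on the diagonal -/

section DiagRectangle

theorem Set.OrdConnected.isPosetInterval {P : Type w} [LinearOrder P] {I : Set P}
    (h : I.OrdConnected) (hne : I.Nonempty) : IsPosetInterval I where
  nonempty := hne
  convex _ hx _ hy _ hxz hzy := h.out hx hy ⟨hxz, hzy⟩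
  connected _ hx _ hy := .single ⟨hx, hy, le_total _ _⟩

theorem isRectangle_prod {P : Type v} {Q : Type w} [LinearOrder P] [LinearOrder Q] {I : Set P}
    {J : Set Q} (hI : I.OrdConnected) (hI' : I.Nonempty) (hJ : J.OrdConnected) (hJ' : J.Nonempty) :
    IsRectangle (I ×ˢ J) := by
  refine ⟨⟨hI'.prod hJ', ?_, ?_⟩, I, J, hI.isPosetInterval hI', hJ.isPosetInterval hJ', rfl⟩
  · exact fun x hx y hy z hxz hzy =>
      ⟨hI.out hx.1 hy.1 ⟨hxz.1, hzy.1⟩, hJ.out hx.2 hy.2 ⟨hxz.2, hzy.2⟩⟩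
  · intro x hx y hy
    -- Each coordinate of the meet is a coordinate of `x` or of `y`, so two comparisons through the
    -- meet connect them.
    have hz : x ⊓ y ∈ I ×ˢ J := by
      constructor
      · rcases le_total x.1 y.1 with h | h
        · simpa [h] using hx.1
        · simpa [h] using hy.1
      · rcases le_total x.2 y.2 with h | h
        · simpa [h] using hx.2
        · simpa [h] using hy.2
    exact .tail (.single ⟨hx, hz, Or.inr inf_le_left⟩) ⟨hz, hy, Or.inl inf_le_right⟩

theorem mem_diagRectangle_top_top {c : ℝ} {p : ℝ × ℝ} :
    p ∈ diagRectangle c ⊤ ⊤ ↔ p.1 < c ∧ c ≤ p.2 := by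
  simp [diagRectangle]

theorem mem_diagRectangle_top_ofReal {c d : ℝ} (h : c < d) {p : ℝ × ℝ} :
    p ∈ diagRectangle c ⊤ (ENNReal.ofReal (d - c)) ↔ p.1 < c ∧ c ≤ p.2 ∧ p.2 < d := by
  have h' : (c : EReal) + (d - c : ℝ) = d := by rw [← EReal.coe_add, add_sub_cancel]
  simp [diagRectangle, EReal.coe_ennreal_ofReal, max_eq_left (sub_pos.2 h).le, h', -EReal.coe_sub]

theorem mem_diagRectangle_ofReal_top {c d : ℝ} (h : d < c) {p : ℝ × ℝ} :
    p ∈ diagRectangle c (ENNReal.ofReal (c - d)) ⊤ ↔ d ≤ p.1 ∧ p.1 < c ∧ c ≤ p.2 := by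
  have h' : (c : EReal) - (c - d : ℝ) = d := by rw [← EReal.coe_sub, sub_sub_cancel]
  simp [diagRectangle, EReal.coe_ennreal_ofReal, max_eq_left (sub_pos.2 h).le, h', -EReal.coe_sub, and_assoc]

theorem isRectangle_diagRectangle {c : ℝ} {ℓ₁ ℓ₂ : ℝ≥0∞} (h : (diagRectangle c ℓ₁ ℓ₂).Nonempty) :
    IsRectangle (diagRectangle c ℓ₁ ℓ₂) := by
  refine isRectangle_prod ⟨?_⟩ (Set.prod_nonempty_iff.1 h).1 ⟨?_⟩ (Set.prod_nonempty_iff.1 h).2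
  · exact fun x hx y hy z hz => ⟨hx.1.trans (EReal.coe_le_coe_iff.2 hz.1), hz.2.trans_lt hy.2⟩
  · exact fun x hx y hy z hz => ⟨hx.1.trans hz.1, (EReal.coe_le_coe_iff.2 hz.2).trans_lt hy.2⟩

/-- Rectangles of type (R) are bounded. -/
theorem IsTypeR.exists_bounds {R : Set (ℝ × ℝ)} (h : IsTypeR R) :
    ∃ m M : ℝ, ∀ p ∈ R, m ≤ p.1 ∧ p.2 < M := by
  obtain ⟨c, ℓ₁, ℓ₂, -, h₁, -, h₂, rfl⟩ := h
  lift ℓ₁ to NNReal using h₁.ne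
  lift ℓ₂ to NNReal using h₂.ne
  refine ⟨c - ℓ₁, c + ℓ₂, fun p hp => ⟨?_, ?_⟩⟩
  · exact EReal.coe_le_coe_iff.1 hp.1.1
  · exact EReal.coe_lt_coe_iff.1 hp.2.2

/-- The possible supports of the indecomposable summands, as described by membership. -/
theorem diagRectangle_classification {R : Set (ℝ × ℝ)} (hne : R.Nonempty) {c : ℝ}
    (h : (∀ p, p ∈ R ↔ p.1 < c ∧ c ≤ p.2) ∨
      (∃ d, ∀ p, p ∈ R ↔ p.1 < c ∧ c ≤ p.2 ∧ p.2 < d) ∨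
      ∃ d, ∀ p, p ∈ R ↔ d ≤ p.1 ∧ p.1 < c ∧ c ≤ p.2) :
    IsRectangle R ∧ (∃ (c : ℝ) (ℓ₁ ℓ₂ : ℝ≥0∞), 0 < ℓ₁ ∧ 0 < ℓ₂ ∧ R = diagRectangle c ℓ₁ ℓ₂) ∧
      (IsTypeS R ∨ IsTypeB R ∨ IsTypeN R) ∧ ¬ IsTypeR R := by
  obtain ⟨p, hp⟩ := hne
  rcases h with h | ⟨d, h⟩ | ⟨d, h⟩
  · obtain rfl : R = diagRectangle c ⊤ ⊤ :=
      Set.ext fun p => (h p).trans mem_diagRectangle_top_top.symm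
    refine ⟨isRectangle_diagRectangle ⟨p, hp⟩, ⟨c, ⊤, ⊤, by simp, by simp, rfl⟩,
      Or.inl ⟨c, rfl⟩, fun hR => ?_⟩
    obtain ⟨m, M, hb⟩ := hR.exists_bounds
    -- In each case the excluded bound is violated by a point far out in an unbounded direction of
    -- the rectangle.
    have := hb (c - 1, max c M) ((h _).2 ⟨by simp, by simp⟩)
    simp at this
  -- Nonemptiness makes the side length positive, so `ENNReal.ofReal` does not truncate it.
  · have hcd : c < d := ((h p).1 hp).2.1.trans_lt ((h p).1 hp).2.2
    obtain rfl : R = diagRectangle c ⊤ (ENNReal.ofReal (d - c)) :=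
      Set.ext fun p => (h p).trans (mem_diagRectangle_top_ofReal hcd).symm
    have hpos : 0 < ENNReal.ofReal (d - c) := by simpa using hcd
    refine ⟨isRectangle_diagRectangle ⟨p, hp⟩, ⟨c, ⊤, _, by simp, hpos, rfl⟩,
      Or.inr (Or.inl ⟨c, _, hpos, ENNReal.ofReal_lt_top, rfl⟩), fun hR => ?_⟩
    obtain ⟨m, M, hb⟩ := hR.exists_bounds
    have := (hb (min c m - 1, c) ((h _).2 ⟨by simp; linarith [min_le_left c m], le_rfl, hcd⟩)).1
    simp only at this
    linarith [min_le_right c m]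
  · have hcd : d < c := ((h p).1 hp).1.trans_lt ((h p).1 hp).2.1
    obtain rfl : R = diagRectangle c (ENNReal.ofReal (c - d)) ⊤ :=
      Set.ext fun p => (h p).trans (mem_diagRectangle_ofReal_top hcd).symm
    have hpos : 0 < ENNReal.ofReal (c - d) := by simpa using hcd
    refine ⟨isRectangle_diagRectangle ⟨p, hp⟩, ⟨c, _, ⊤, hpos, by simp, rfl⟩,
      Or.inr (Or.inr ⟨c, _, hpos, ENNReal.ofReal_lt_top, rfl⟩), fun hR => ?_⟩
    obtain ⟨m, M, hb⟩ := hR.exists_bounds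
    have := (hb (d, max c M) ((h _).2 ⟨le_rfl, hcd, by simp⟩)).2
    simp at this

end DiagRectangle

/-! ### Floer-type complexes over the ground field -/

section GroundField

variable {F : Type u} [Field F]

theorem Novikov.const_surjective : Function.Surjective (Novikov.const F ⊥) := fun x => by
  refine ⟨(x : HahnSeries (⊥ : AddSubgroup ℝ) F).coeff 0, Subtype.ext (HahnSeries.ext ?_)⟩
  funext g
  obtain rfl : g = 0 := Subsingleton.elim _ _
  exact HahnSeries.coeff_single_same _ _

theorem novikovVal_mem_of_bot (x : Novikov F ⊥) : novikovVal x = ⊤ ∨ novikovVal x = 0 := by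
  obtain ⟨c, rfl⟩ := Novikov.const_surjective x
  by_cases hc : c = 0
  · exact Or.inl (by rw [hc, map_zero, novikovVal_zero])
  · exact Or.inr (novikovVal_const hc)

/-- Valuations of scalars are only $0$ or $\infty$, so every norm is $-\infty$ or the norm of an
orthogonal basis vector. -/
theorem IsOrthogonalizable.finite_range {V : Type w} [AddCommGroup V] [Module (Novikov F ⊥) V]
    {ℓ : V → EReal} (h : IsOrthogonalizable (F := F) (Γ := ⊥) ℓ) : (Set.range ℓ).Finite := by
  obtain ⟨-, n, b, hb⟩ := h
  refine (((Set.finite_range fun i => ℓ (b i))).insert ⊥).subset ?_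
  rintro _ ⟨x, rfl⟩
  rw [← b.sum_repr x, hb]
  refine Finset.sup_mem _ (Set.mem_insert _ _) ?_ Finset.univ _ ?_
  · intro s hs t ht
    rcases max_choice s t with h | h <;> rw [show s ⊔ t = max s t from rfl, h] <;> assumption
  · intro i _
    rcases novikovVal_mem_of_bot (b.repr x i) with h | h
    · rw [h, EReal.sub_top]
      exact Set.mem_insert _ _
    · rw [h, sub_zero]
      exact Set.mem_insert_of_mem _ ⟨i, rfl⟩

namespace FloerTypeComplex

/-- Every scalar is a constant series, so a basis over the Novikov field also spans over `F`. -/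
theorem finiteDimensional_groundComplex (C : FloerTypeComplex.{u, w} F ⊥) (k : ℤ) :
    FiniteDimensional F (C.groundComplex.X k) := by
  obtain ⟨-, n, b, -⟩ := C.orthogonalizable k
  refine Module.finite_def.2 ((Submodule.fg_def (R := F) (M := C.groundComplex.X k)).2
    ⟨Set.range b, Set.finite_range b, ?_⟩)
  rw [eq_top_iff]
  intro x _
  have hx : (x : C.complex.X k) ∈ Submodule.span (Novikov F ⊥) (Set.range b) := by
    rw [b.span_eq]; trivial
  induction hx using Submodule.span_induction with
  | mem x h => exact Submodule.subset_span h
  | zero => exact Submodule.zero_mem _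
  | add x y _ _ hx hy => exact Submodule.add_mem _ (hx trivial) (hy trivial)
  | smul c x _ hx =>
    obtain ⟨c, rfl⟩ := Novikov.const_surjective c
    exact Submodule.smul_mem _ c (hx trivial)

end FloerTypeComplex

end GroundField

/-! ### Interlevel homology as a subquotient -/

namespace FloerTypeComplex

section InterlevelHomology

variable {F : Type u} [Field F] {Γ : AddSubgroup ℝ} (C : FloerTypeComplex.{u, w} F Γ)

/-- The chains representing cycles of `C_*^{(a,b]}`. -/
noncomputable def interlevelCycles (p : ℝ × ℝ) (k : ℤ) : Submodule F (C.groundComplex.X k) :=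
  C.sublevel p.2 k ⊓ (C.sublevel p.1 (k - 1)).comap (C.groundComplex.d k (k - 1)).hom

/-- The chains representing boundaries of `C_*^{(a,b]}`. -/
noncomputable def interlevelBoundaries (p : ℝ × ℝ) (k : ℤ) : Submodule F (C.groundComplex.X k) :=
  (C.sublevel p.1 k ⊓ C.sublevel p.2 k) ⊔
    (C.sublevel p.2 (k + 1)).map (C.groundComplex.d (k + 1) k).hom

theorem monotone_interlevelCycles (k : ℤ) : Monotone fun p => C.interlevelCycles p k :=
  fun _ _ h => inf_le_inf (C.sublevel_mono h.2 k) (Submodule.comap_mono (C.sublevel_mono h.1 _))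

/-- The class in `C_k^{(a,b]}` of a chain representing a cycle. -/
noncomputable def interlevelCyclesToChains (p : ℝ × ℝ) (k : ℤ) :
    C.interlevelCycles p k →ₗ[F] C.InterlevelChains p.1 p.2 k :=
  (Submodule.mkQ _).comp (Submodule.inclusion inf_le_left)

/-- The map from chains representing cycles to the cycles of `C_*^{(a,b]}`. -/
noncomputable def interlevelCyclesLift (p : ℝ × ℝ) (k : ℤ) :
    ModuleCat.of F (C.interlevelCycles p k) ⟶ (C.interlevelComplex p.1 p.2).cycles k :=
  (C.interlevelComplex p.1 p.2).liftCycles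
    (show _ ⟶ (C.interlevelComplex p.1 p.2).X k from
      ModuleCat.ofHom (C.interlevelCyclesToChains p k)) (k - 1) (by simp) (by
        refine ModuleCat.hom_ext (LinearMap.ext fun z => ?_)
        exact (Submodule.Quotient.mk_eq_zero _).2 z.2.2)

theorem iCycles_interlevelCyclesLift (p : ℝ × ℝ) (k : ℤ) (z : C.interlevelCycles p k) :
    (C.interlevelComplex p.1 p.2).iCycles k (C.interlevelCyclesLift p k z) =
      C.interlevelCyclesToChains p k z :=
  congrArg (fun f : ModuleCat.of F (C.interlevelCycles p k) ⟶
    (C.interlevelComplex p.1 p.2).X k => f.hom z)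
    ((C.interlevelComplex p.1 p.2).liftCycles_i _ _ _ _)

/-- The homology class in `H_k^{(a,b]}` of a chain representing a cycle. -/
noncomputable def interlevelClass (p : ℝ × ℝ) (k : ℤ) :
    C.interlevelCycles p k →ₗ[F] (C.interlevelComplex p.1 p.2).homology k :=
  (C.interlevelCyclesLift p k ≫ (C.interlevelComplex p.1 p.2).homologyπ k).hom

/-- A cycle is determined by its underlying chain because `iCycles` is a monomorphism; classes can
thus be computed from any cycle with the right chain. -/
theorem interlevelClass_eq (p : ℝ × ℝ) (k : ℤ) (z : C.interlevelCycles p k)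
    (y : (C.interlevelComplex p.1 p.2).cycles k)
    (h : (C.interlevelComplex p.1 p.2).iCycles k y = C.interlevelCyclesToChains p k z) :
    C.interlevelClass p k z = (C.interlevelComplex p.1 p.2).homologyπ k y := by
  have h1 : C.interlevelCyclesLift p k z = y :=
    (ModuleCat.mono_iff_injective ((C.interlevelComplex p.1 p.2).iCycles k)).1 inferInstance
      ((C.iCycles_interlevelCyclesLift p k z).trans h.symm)
  rw [← h1]
  rfl

theorem interlevelClass_surjective (p : ℝ × ℝ) (k : ℤ) :
    Function.Surjective (C.interlevelClass p k) := by
  intro h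
  obtain ⟨y, rfl⟩ := (ModuleCat.epi_iff_surjective
    ((C.interlevelComplex p.1 p.2).homologyπ k)).1 inferInstance h
  obtain ⟨x, hx⟩ := Submodule.Quotient.mk_surjective _
    ((C.interlevelComplex p.1 p.2).iCycles k y : C.InterlevelChains p.1 p.2 k)
  have hd : C.interlevelD p.1 p.2 k (k - 1)
      ((C.interlevelComplex p.1 p.2).iCycles k y : C.InterlevelChains p.1 p.2 k) = 0 :=
    congrArg (fun f => f.hom y) ((C.interlevelComplex p.1 p.2).iCycles_d k (k - 1))
  rw [← hx] at hd
  have hd' : (C.groundComplex.d k (k - 1)).hom x ∈ C.sublevel p.1 (k - 1) :=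
    (Submodule.Quotient.mk_eq_zero
      ((C.sublevel p.1 (k - 1)).submoduleOf (C.sublevel p.2 (k - 1)))).1 hd
  exact ⟨⟨x, x.2, hd'⟩, C.interlevelClass_eq p k _ y hx.symm⟩

/-- Since `homologyι` is a monomorphism, a class vanishes exactly when its chain is a boundary in
the quotient complex. Lifting to $C_k$ leaves an error term in $C_k^a$. -/
theorem interlevelClass_eq_zero_iff (p : ℝ × ℝ) (k : ℤ) (z : C.interlevelCycles p k) :
    C.interlevelClass p k z = 0 ↔ (z : C.groundComplex.X k) ∈ C.interlevelBoundaries p k := by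
  have h1 : (C.interlevelComplex p.1 p.2).homologyι k (C.interlevelClass p k z) =
      (C.interlevelComplex p.1 p.2).pOpcycles k (C.interlevelCyclesToChains p k z) := by
    rw [← C.iCycles_interlevelCyclesLift]
    exact congrArg (fun f => f.hom (C.interlevelCyclesLift p k z))
      ((C.interlevelComplex p.1 p.2).homology_π_ι k)
  have h2 : C.interlevelClass p k z = 0 ↔
      (C.interlevelComplex p.1 p.2).pOpcycles k (C.interlevelCyclesToChains p k z) = 0 := by
    rw [← h1]
    exact (map_eq_zero_iff _ ((ModuleCat.mono_iff_injective
      ((C.interlevelComplex p.1 p.2).homologyι k)).1 inferInstance)).symm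
  have h3 : (C.interlevelComplex p.1 p.2).pOpcycles k (C.interlevelCyclesToChains p k z) = 0 ↔
      ∃ y : C.InterlevelChains p.1 p.2 (k + 1),
        C.interlevelD p.1 p.2 (k + 1) k y = C.interlevelCyclesToChains p k z := by
    refine (ShortComplex.moduleCat_pOpcycles_eq_zero_iff
      ((C.interlevelComplex p.1 p.2).sc k) _).trans ?_
    have := (ComplexShape.down ℤ).prev_eq' (show (ComplexShape.down ℤ).Rel (k + 1) k from rfl)
    change (∃ y, ((C.interlevelComplex p.1 p.2).d ((ComplexShape.down ℤ).prev k) k).hom y = _) ↔ _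
    rw [this]
    rfl
  rw [h2, h3]
  constructor
  · rintro ⟨y, hy⟩
    obtain ⟨y, rfl⟩ := Submodule.Quotient.mk_surjective _ y
    have hmem : (z : C.groundComplex.X k) - (C.groundComplex.d (k + 1) k).hom y ∈
        C.sublevel p.1 k :=
      (Submodule.Quotient.eq ((C.sublevel p.1 k).submoduleOf (C.sublevel p.2 k))).1 hy.symm
    -- The error $z-\partial y$ also lies in $C_k^b$, since both terms do; no order between $a$ and
    -- $b$ is needed.
    refine Submodule.mem_sup.2 ⟨_, ⟨hmem, Submodule.sub_mem _ z.2.1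
      (C.d_mem_sublevel p.2 (k + 1) k y.2)⟩, _, ⟨y, y.2, rfl⟩, ?_⟩
    exact sub_add_cancel _ _
  · intro hz
    obtain ⟨x, hx, _, ⟨y, hy, rfl⟩, hxy⟩ := Submodule.mem_sup.1 hz
    refine ⟨Submodule.Quotient.mk ⟨y, hy⟩, Eq.symm ((Submodule.Quotient.eq _).2 ?_)⟩
    change (z : C.groundComplex.X k) - (C.groundComplex.d (k + 1) k).hom y ∈ C.sublevel p.1 k
    rw [← hxy, add_sub_cancel_right]
    exact hx.1

theorem homologyMap_interlevelClass {p q : ℝ × ℝ} (h : p ≤ q) (k : ℤ)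
    (z : C.interlevelCycles p k) :
    HomologicalComplex.homologyMap (C.interlevelChainMap h.1 h.2) k (C.interlevelClass p k z) =
      C.interlevelClass q k (Submodule.inclusion (C.monotone_interlevelCycles k h) z) := by
  rw [C.interlevelClass_eq q k _ (HomologicalComplex.cyclesMap (C.interlevelChainMap h.1 h.2) k
    (C.interlevelCyclesLift p k z))]
  · exact congrArg (fun f => f.hom (C.interlevelCyclesLift p k z))
      (HomologicalComplex.homologyπ_naturality (C.interlevelChainMap h.1 h.2) k)
  · refine (congrArg (fun f => f.hom (C.interlevelCyclesLift p k z))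
      (HomologicalComplex.cyclesMap_i (C.interlevelChainMap h.1 h.2) k)).trans ?_
    exact congrArg ((C.interlevelChainMap h.1 h.2).f k).hom (C.iCycles_interlevelCyclesLift p k z)

end InterlevelHomology

end FloerTypeComplex

/-! ### Filtration levels and the decomposition -/

namespace FloerTypeComplex

section Levels

variable {F : Type u} [Field F] {Γ : AddSubgroup ℝ} (C : FloerTypeComplex.{u, w} F Γ)

theorem ℓ_ne_bot {k : ℤ} {x : C.groundComplex.X k} (hx : x ≠ 0) : C.ℓ k x ≠ ⊥ :=
  fun h => hx (((C.orthogonalizable k).1.eq_bot_iff (V := C.complex.X k) x).1 h)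

theorem exists_forall_mem_sublevel_iff {k : ℤ} {x : C.groundComplex.X k} (hx : x ≠ 0) :
    ∃ c : ℝ, ∀ t : ℝ, x ∈ C.sublevel t k ↔ c ≤ t := by
  have hc := EReal.coe_toReal ((C.orthogonalizable k).1.ne_top (V := C.complex.X k) x)
    (C.ℓ_ne_bot hx)
  refine ⟨(C.ℓ k x).toReal, fun t => ?_⟩
  rw [← EReal.coe_le_coe_iff, hc]
  rfl

theorem groundComplex_d_d (i j k : ℤ) (x : C.groundComplex.X i) :
    (C.groundComplex.d j k).hom ((C.groundComplex.d i j).hom x) = 0 :=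
  congrArg (fun f => f.hom x) (C.groundComplex.d_comp_d i j k)

theorem isChain_range_sublevel (k : ℤ) :
    IsChain (· ≤ ·) (Set.range fun t : ℝ => C.sublevel t k) := by
  rintro _ ⟨s, rfl⟩ _ ⟨t, rfl⟩ -
  exact (le_total s t).imp (fun h => C.sublevel_mono h k) fun h => C.sublevel_mono h k

/-- The images and preimages of the filtration levels under the boundary operators form a chain. -/
theorem isChain_map_union_comap_sublevel (k : ℤ) :
    IsChain (· ≤ ·)
      ((Set.range fun t : ℝ => (C.sublevel t (k + 1)).map (C.groundComplex.d (k + 1) k).hom) ∪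
        Set.range fun t : ℝ => (C.sublevel t (k - 1)).comap (C.groundComplex.d k (k - 1)).hom) := by
  -- Every image lies below every preimage, because $\partial^2=0$.
  have h : ∀ s t : ℝ, (C.sublevel s (k + 1)).map (C.groundComplex.d (k + 1) k).hom ≤
      (C.sublevel t (k - 1)).comap (C.groundComplex.d k (k - 1)).hom := by
    rintro s t _ ⟨x, -, rfl⟩
    rw [Submodule.mem_comap, groundComplex_d_d]
    exact Submodule.zero_mem _
  rintro _ (⟨s, rfl⟩ | ⟨s, rfl⟩) _ (⟨t, rfl⟩ | ⟨t, rfl⟩) -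
  · exact (le_total s t).imp (fun h => Submodule.map_mono (C.sublevel_mono h _))
      fun h => Submodule.map_mono (C.sublevel_mono h _)
  · exact Or.inl (h s t)
  · exact Or.inr (h t s)
  · exact (le_total s t).imp (fun h => Submodule.comap_mono (C.sublevel_mono h _))
      fun h => Submodule.comap_mono (C.sublevel_mono h _)

/-- If the filtration function has finite range, a boundary has a primitive of minimal level. -/
theorem exists_forall_mem_map_sublevel_iff {k : ℤ} (hfin : (Set.range (C.ℓ (k + 1))).Finite)
    {x : C.groundComplex.X k} (hx : x ≠ 0)
    (hx' : x ∈ LinearMap.range (C.groundComplex.d (k + 1) k).hom) :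
    ∃ c : ℝ, ∀ t : ℝ,
      x ∈ (C.sublevel t (k + 1)).map (C.groundComplex.d (k + 1) k).hom ↔ c ≤ t := by
  obtain ⟨y₀, hy₀⟩ := hx'
  have hfin' : ((C.ℓ (k + 1)) ''
      {y : C.groundComplex.X (k + 1) | (C.groundComplex.d (k + 1) k).hom y = x}).Finite :=
    hfin.subset (Set.image_subset_range _ _)
  -- Finiteness of the range makes the infimum over all primitives a minimum. The minimizer is
  -- nonzero because `x` is, so its level is real.
  obtain ⟨_, ⟨y, hy, rfl⟩, hmin⟩ := Set.exists_min_image _ id hfin' ⟨_, y₀, hy₀, rfl⟩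
  have hy0 : y ≠ 0 := by
    rintro rfl
    exact hx (hy.symm.trans (map_zero _))
  obtain ⟨c, hc⟩ := C.exists_forall_mem_sublevel_iff hy0
  refine ⟨c, fun t => ⟨?_, fun h => ⟨y, (hc t).2 h, hy⟩⟩⟩
  rintro ⟨z, hz, hzx⟩
  exact (hc t).1 ((hmin _ ⟨z, hzx, rfl⟩).trans hz)

/-- The set of `(a, b)` where a chain with given level represents a nonzero class is described by
one of three kinds of inequalities, according to whether the chain is a boundary, a cycle that is
not a boundary, or not a cycle. -/
theorem exists_mem_interlevelCycles_iff {k : ℤ} (hfin : (Set.range (C.ℓ (k + 1))).Finite)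
    {x : C.groundComplex.X k} (hx : x ≠ 0) {R : Set (ℝ × ℝ)}
    (hR : ∀ p, p ∈ R ↔ x ∈ C.interlevelCycles p k ∧
      ¬ (x ∈ C.sublevel p.1 k ⊓ C.sublevel p.2 k ∨
        x ∈ (C.sublevel p.2 (k + 1)).map (C.groundComplex.d (k + 1) k).hom)) :
    ∃ c : ℝ, (∀ p, p ∈ R ↔ p.1 < c ∧ c ≤ p.2) ∨
      (∃ d, ∀ p, p ∈ R ↔ p.1 < c ∧ c ≤ p.2 ∧ p.2 < d) ∨
      ∃ d, ∀ p, p ∈ R ↔ d ≤ p.1 ∧ p.1 < c ∧ c ≤ p.2 := by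
  obtain ⟨c, hc⟩ := C.exists_forall_mem_sublevel_iff hx
  refine ⟨c, ?_⟩
  by_cases hb : x ∈ LinearMap.range (C.groundComplex.d (k + 1) k).hom
  -- Here `d` is the least level of a primitive; the class dies once `p.2` reaches it.
  · obtain ⟨d, hd⟩ := C.exists_forall_mem_map_sublevel_iff hfin hx hb
    have hdx : (C.groundComplex.d k (k - 1)).hom x = 0 := by
      obtain ⟨y, rfl⟩ := hb
      exact C.groundComplex_d_d _ _ _ y
    refine Or.inr (Or.inl ⟨d, fun p => ?_⟩)
    rw [hR, interlevelCycles, Submodule.mem_inf, Submodule.mem_inf, Submodule.mem_comap, hdx, hc, hc,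
      hd]
    simp only [Submodule.zero_mem, and_true, not_or, not_and, not_le]
    exact ⟨fun h => ⟨not_le.1 fun h' => h.2.1 h' |>.not_ge h.1, h.1, h.2.2⟩,
      fun h => ⟨h.2.1, fun h' => (h'.not_gt h.1).elim, h.2.2⟩⟩
  · have hb' : ∀ t : ℝ, x ∉ (C.sublevel t (k + 1)).map (C.groundComplex.d (k + 1) k).hom := by
      rintro t ⟨y, -, hy⟩
      exact hb ⟨y, hy⟩
    by_cases hdx : (C.groundComplex.d k (k - 1)).hom x = 0
    · refine Or.inl fun p => ?_
      rw [hR, interlevelCycles, Submodule.mem_inf, Submodule.mem_inf, Submodule.mem_comap, hdx, hc,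
        hc]
      simp only [Submodule.zero_mem, and_true, hb', or_false, not_and, not_le]
      exact ⟨fun h => ⟨not_le.1 fun h' => (h.2 h').not_ge h.1, h.1⟩,
        fun h => ⟨h.2, fun h' => (h'.not_gt h.1).elim⟩⟩
    -- Here `d` is the level of $\partial x$; the chain becomes a relative cycle only once `p.1`
    -- reaches it.
    · obtain ⟨d, hd⟩ := C.exists_forall_mem_sublevel_iff hdx
      refine Or.inr (Or.inr ⟨d, fun p => ?_⟩)
      rw [hR, interlevelCycles, Submodule.mem_inf, Submodule.mem_inf, Submodule.mem_comap, hc, hc,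
        hd]
      simp only [hb', or_false, not_and, not_le]
      exact ⟨fun h => ⟨h.1.2, not_le.1 fun h' => (h.2 h').not_ge h.1.1, h.1.1⟩,
        fun h => ⟨⟨h.2.2, h.1⟩, fun h' => (h'.not_gt h.2.1).elim⟩⟩

end Levels

end FloerTypeComplex

/-! ### The decomposition for trivial Γ -/

theorem theorem4p1 {F : Type u} [Field F] {Γ : AddSubgroup ℝ} (hΓ : Γ = ⊥)
    (C : FloerTypeComplex.{u, max u v} F Γ) (k : ℤ) :
    ∃ (ι : Type) (R : ι → Set (ℝ × ℝ)) (hR : ∀ i, IsRectangle (R i)),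
      Nonempty (C.bipersistenceModule k ≅
        PersistenceModule.directSum fun i => intervalModule.{u, v, 0} F (R i) (hR i).1) ∧
      ∀ i,
        (∃ (c : ℝ) (ℓ₁ ℓ₂ : ℝ≥0∞), 0 < ℓ₁ ∧ 0 < ℓ₂ ∧ R i = diagRectangle c ℓ₁ ℓ₂) ∧
        (IsTypeS (R i) ∨ IsTypeB (R i) ∨ IsTypeN (R i)) ∧
        ¬ IsTypeR (R i) := by
  subst hΓ
  have := C.finiteDimensional_groundComplex k
  obtain ⟨b, hb⟩ := exists_basis_isAdapted_of_isChain F _ (C.groundComplex.X k) rfl _ _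
    (C.isChain_range_sublevel k) (C.isChain_map_union_comap_sublevel k)
  have hL : ∀ t, b.IsAdapted (C.sublevel t k) := fun t => hb _ (Or.inl ⟨t, rfl⟩)
  have hmap : ∀ t, b.IsAdapted ((C.sublevel t (k + 1)).map (C.groundComplex.d (k + 1) k).hom) :=
    fun t => hb _ (Or.inr (Or.inl ⟨t, rfl⟩))
  have hcomap : ∀ t,
      b.IsAdapted ((C.sublevel t (k - 1)).comap (C.groundComplex.d k (k - 1)).hom) :=
    fun t => hb _ (Or.inr (Or.inr ⟨t, rfl⟩))
  let S : Fin (Module.finrank F (C.groundComplex.X k)) → Set (ℝ × ℝ) := fun i =>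
    {p | b i ∈ C.interlevelCycles p k ∧ b i ∉ C.interlevelBoundaries p k}
  -- Basis vectors with empty support contribute nothing and are dropped, since intervals must be
  -- nonempty.
  have key : ∀ i : {i // (S i).Nonempty}, _ := fun i =>
    have h := C.exists_mem_interlevelCycles_iff (C.orthogonalizable (k + 1)).finite_range
      (b.ne_zero i.1) (R := S i.1) fun p => and_congr_right' (not_congr
        (((hL p.1).inf (hL p.2)).mem_sup_iff (hmap p.2)))
    diagRectangle_classification i.2 h.choose_spec
  refine ⟨{i // (S i).Nonempty}, fun i => S i.1, fun i => (key i).1, ?_, fun i => (key i).2⟩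
  exact nonempty_iso_directSum_intervalModule.{u, v, 0} (C.bipersistenceModule k)
    (fun p => C.interlevelCycles p k) (fun p => C.interlevelBoundaries p k)
    (C.monotone_interlevelCycles k) (fun p => C.interlevelClass p k)
    (fun p => C.interlevelClass_surjective p k) (fun p => C.interlevelClass_eq_zero_iff p k)
    (fun f => C.homologyMap_interlevelClass (leOfHom f) k) b
    (fun p => (hL p.2).inf (hcomap p.1)) (fun p => ((hL p.1).inf (hL p.2)).sup (hmap p.2))
    (fun i : {i // (S i).Nonempty} => i.1) Subtype.val_injective (fun i => S i.1)
    (fun i => (key i).1.1) (fun _ _ => Iff.rfl) fun i p h h' => ⟨⟨i, p, h, h'⟩, rfl⟩
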